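/- Cut a deck of $n\ge 0$ cards, labelled $1,\dots,n$ from the top, into $k\ge 1$ consecutive piles whose sizes are $j_1,\dots,j_k$ ($j_1+\cdots+j_k=n$) with probability $\frac{1}{k^n}\binom{n}{j_1,\dots,j_k}$, and then choose uniformly at random one of the interleavings of the piles (the arrangements of the $n$ cards in which the cards of each pile keep their relative order). The Bayer--Diaconis $k$-shuffle is the resulting random permutation $w\in S_n$, where $w(i)$ is the label of the card in position $i$ of the new deck. A (cycle) shape $s$ is a transitive permutation of $\{1,\dots,|s|\}$, $|s|\ge 1$, i.e. an $|s|$-cycle (the identity of $S_1$ if $|s|=1$). The shape of a cycle $(i_1\cdots i_m)$ of a permutation (fixed points included) is the cycle $(\tau(i_1)\cdots\tau(i_m))$, where $\tau$ is the order preserving bijection from $\{i_1,\dots,i_m\}$ to $\{1,\dots,m\}$. Let $d(u)$ denote the number of descents of $u\in S_m$, that is, of $i<m$ with $u(i)>u(i+1)$. **Proposition.** Let $(n_s)_s$ be non-negative integers indexed by all shapes $s$ with $\sum_s |s|\,n_s=n$. Then the probability that, for every shape $s$, the $k$-shuffle $w\in S_n$ has exactly $n_s$ cycles of shape $s$ is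 $$\frac{1}{k^n}\prod_{s}\binom{\binom{|s|+k-d(s^{-1})-1}{|s|}+n_s-1}{n_s},$$ where $\binom{a}{0}=1$ for every integer $a\ge -1$; thus all factors with $n_s=0$ are equal to $1$, and the product is finite. -/

import Mathlib

open scoped ENNReal

namespace RiffleShuffle

/-- The number of descents of a permutation `w` of `{0, …, m-1}`: the number of positions `i`
with `i + 1 < m` and `w (i + 1) < w i`. -/
noncomputable def numDescents {m : ℕ} (w : Equiv.Perm (Fin m)) : ℕ :=
  Nat.card {i : Fin m // ∃ h : (i : ℕ) + 1 < m, w ⟨(i : ℕ) + 1, h⟩ < w i}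

/-- A cycle shape: a positive integer `size` and a transitive permutation (a cycle moving through
all symbols) of the `size` symbols `{0, …, size-1}`. For `size = 1` it is a fixed point. -/
structure CycleShape where
  size : ℕ
  size_pos : 0 < size
  perm : Equiv.Perm (Fin size)
  transitive : ∀ i j, perm.SameCycle i j

open Classical in
/-- The supports of the cycles of `w`, fixed points included. -/
noncomputable def cycleSupports {n : ℕ} (w : Equiv.Perm (Fin n)) : Finset (Finset (Fin n)) :=
  Finset.univ.image fun i => Finset.univ.filter fun j => w.SameCycle i j

/-- The cycle of `w` on the symbols `O` has shape `s`: the order preserving bijection `τ` between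
`{0, …, |s|-1}` and `O` carries the cycle `s.perm` to the restriction of `w` to `O`. -/
def HasShape {n : ℕ} (w : Equiv.Perm (Fin n)) (O : Finset (Fin n)) (s : CycleShape) : Prop :=
  ∃ τ : Fin s.size ≃o O, ∀ a, w (τ a : Fin n) = (τ (s.perm a) : Fin n)

open Classical in
/-- The number of cycles of `w` of shape `s`. -/
noncomputable def numCyclesOfShape {n : ℕ} (w : Equiv.Perm (Fin n)) (s : CycleShape) : ℕ :=
  ((cycleSupports w).filter fun O => HasShape w O s).card

/-- The distribution of the pile sizes `j₁, …, j_k` in cutting a deck of `n` cards: the sizes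
`j` with sum `n` have probability `n! / (j₁! ⋯ j_k!) / k ^ n`. -/
noncomputable def pileSizes (k n : ℕ) (hk : 0 < k) : PMF (Fin k → ℕ) :=
  PMF.ofFinset
    (fun j => if ∑ a, j a = n then (Nat.multinomial Finset.univ j : ℝ≥0∞) / (k : ℝ≥0∞) ^ n else 0)
    (Finset.piAntidiag Finset.univ n)
    (by
      have h1 : ∑ j ∈ Finset.piAntidiag (Finset.univ : Finset (Fin k)) n,
          Nat.multinomial Finset.univ j = k ^ n := by
        have h := Finset.sum_pow_eq_sum_piAntidiag (Finset.univ : Finset (Fin k))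
          (fun _ => (1 : ℕ)) n
        simpa using h.symm
      rw [Finset.sum_congr rfl (g := fun j : Fin k → ℕ =>
        (Nat.multinomial Finset.univ j : ℝ≥0∞) / (k : ℝ≥0∞) ^ n)
        (fun j hj => if_pos (Finset.mem_piAntidiag.1 hj).1)]
      simp only [div_eq_mul_inv]
      rw [← Finset.sum_mul, ← Nat.cast_sum, h1, Nat.cast_pow]
      have hk' : (k : ℝ≥0∞) ≠ 0 := by exact_mod_cast hk.ne'
      exact ENNReal.mul_inv_cancel (pow_ne_zero _ hk') (ENNReal.pow_ne_top (ENNReal.natCast_ne_top k)))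
    (by
      intro j hj
      refine if_neg fun h => hj ?_
      simpa using h)

/-- The cards (labelled `0, …, n-1` from the top of the deck) in the pile number `a`, when the deck
is cut into consecutive piles of sizes `j`. -/
def pile {k : ℕ} (n : ℕ) (j : Fin k → ℕ) (a : Fin k) : Finset (Fin n) :=
  Finset.univ.filter fun c =>
    ∑ b ∈ Finset.Iio a, j b ≤ (c : ℕ) ∧ (c : ℕ) < ∑ b ∈ Finset.Iic a, j b

open Classical in
/-- The interleavings of the piles of sizes `j`. A permutation `w` stands for the deck in which the
card at position `i` is `w i`; it is an interleaving if the cards of each pile keep their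
relative order (`w.symm c` is the position of the card `c`). -/
noncomputable def interleavings {k : ℕ} (n : ℕ) (j : Fin k → ℕ) : Finset (Equiv.Perm (Fin n)) :=
  Finset.univ.filter fun w => ∀ a, StrictMonoOn w.symm (pile n j a : Set (Fin n))

theorem interleavings_nonempty {k : ℕ} (n : ℕ) (j : Fin k → ℕ) : (interleavings n j).Nonempty :=
  ⟨1, by
    simp only [interleavings, Finset.mem_filter, Finset.mem_univ, true_and]
    intro a x _ y _ h
    exact h⟩

/-- The Bayer–Diaconis `k`-shuffle: cut the deck of `n` cards into `k` piles of multinomial sizes,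
then choose an interleaving of the piles uniformly at random. -/
noncomputable def kShuffle (k n : ℕ) (hk : 0 < k) : PMF (Equiv.Perm (Fin n)) :=
  (pileSizes k n hk).bind fun j =>
    PMF.uniformOfFinset (interleavings n j) (interleavings_nonempty n j)

end RiffleShuffle

/-!
A `k`-shuffle is the inverse of a stable sort of a random word: giving each position of the new deck
the number of the pile its card comes from, a uniformly random word `x : Fin n → Fin k` becomes a
`k`-shuffle, namely its standardization `std x` (`kShuffle_toOuterMeasure`). The probability is
therefore `1 / k ^ n` times the number of words whose standardization has `ns s` cycles of each
shape `s`.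

These words are counted by the bijection of Gessel and Reutenauer. If `O` is the support of a cycle
of `std x` of shape `s`, the subword of `x` at the positions in `O` is a word with standardization
`s`. Hence `x` gives for each `s` a multiset of `ns s` such words (`cycleWords`), and this is a
bijection:

* Each position `i` has a key, the infinite word read off `x` when going backwards along the cycle
  through `i`. The keys, ordered lexicographically, increase weakly with the position
  (`IsStd.key_monotone`), and the cycle words determine the multiset of the keys. So they determine
  the key of each position, and with it the letter there, as keys are periodic
  (`eq_of_cycleWords_eq`).
* Given a family of cycle words, the keys of the positions in it are defined, and they are distinct
  within each cycle (`IsStd.eq_of_key_eq`). Ordering all positions by their keys, ties being broken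
  by a numbering of the cycles, gives a word with these cycle words (`exists_assembly`).

Finally, the number of words with standardization `s` is
`(|s| + k - d(s⁻¹) - 1).choose |s|` (`card_std_eq`): such a word, read in sorted order, is weakly
increasing, and strictly so at the descents of `s⁻¹`. The product formula follows, each factor
counting multisets.
-/

namespace RiffleShuffle

theorem perm_inv_apply_self {α : Type*} (w : Equiv.Perm α) (i : α) : w⁻¹ (w i) = i :=
  w.symm_apply_apply i

theorem perm_apply_inv_self {α : Type*} (w : Equiv.Perm α) (i : α) : w (w⁻¹ i) = i :=
  w.apply_symm_apply i

/-! ### Standardization of words -/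

/-- The standardization of a word `x`: the permutation numbering the positions of `x` so that
smaller letters come first, and equal letters are numbered from left to right. -/
def std {n k : ℕ} (x : Fin n → Fin k) : Equiv.Perm (Fin n) := (Tuple.sort x)⁻¹

/-- `w` sorts the positions of the word `x` stably: it preserves the lexicographic order of the
pairs (letter, position). -/
def IsStd {α β : Type*} [LT α] [LT β] (w : Equiv.Perm α) (x : α → β) : Prop :=
  ∀ i j, (x i < x j ∨ x i = x j ∧ i < j) → w i < w j

theorem IsStd.lt_iff {α β : Type*} [LinearOrder α] [LinearOrder β] {w : Equiv.Perm α} {x : α → β}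
    (h : IsStd w x) (i j : α) : w i < w j ↔ (x i < x j ∨ x i = x j ∧ i < j) := by
  refine ⟨fun hw => ?_, h i j⟩
  by_contra hc
  rcases eq_or_ne i j with rfl | hij
  · exact lt_irrefl _ hw
  · refine lt_asymm hw (h j i ?_)
    push Not at hc
    rcases hc.1.eq_or_lt with he | hl
    · exact .inr ⟨he, lt_of_le_of_ne (hc.2 he.symm) hij.symm⟩
    · exact .inl hl

theorem std_eq_iff {n k : ℕ} {x : Fin n → Fin k} {w : Equiv.Perm (Fin n)} :
    std x = w ↔ IsStd w x := by
  rw [std, inv_eq_iff_eq_inv, eq_comm, Tuple.eq_sort_iff]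
  constructor
  · rintro ⟨h1, h2⟩ i j hij
    by_contra! hc
    rcases hij with hl | ⟨he, hl⟩
    · have := h1 hc
      simp only [Function.comp_apply, perm_inv_apply_self] at this
      exact absurd hl this.not_gt
    · have hne : w j < w i := lt_of_le_of_ne hc (w.injective.ne hl.ne')
      have := h2 _ _ hne (by simp [he])
      simp only [perm_inv_apply_self] at this
      exact lt_asymm hl this
  · intro h
    refine ⟨fun a b hab => ?_, fun a b hab he => ?_⟩
    · by_contra! hc
      have := h _ _ (.inl hc)
      simp only [perm_apply_inv_self] at this
      exact absurd hab this.not_ge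
    · have := (h.lt_iff (w⁻¹ a) (w⁻¹ b)).1 (by simpa using hab)
      rcases this with hl | hr
      · exact absurd he hl.ne
      · exact hr.2

theorem isStd_std {n k : ℕ} (x : Fin n → Fin k) : IsStd (std x) x := std_eq_iff.1 rfl

/-- A monotone tuple is determined by how often its values are below each bound. -/
theorem eq_of_monotone_of_card_le_eq {n : ℕ} {α : Type*} [LinearOrder α] {f g : Fin n → α}
    (hf : Monotone f) (hg : Monotone g)
    (h : ∀ a, (Finset.univ.filter fun i => f i ≤ a).card =
      (Finset.univ.filter fun i => g i ≤ a).card) : f = g := by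
  funext j
  refine eq_of_forall_ge_iff fun a => ?_
  rw [← Tuple.lt_card_le_iff_apply_le_of_monotone hf, h,
    Tuple.lt_card_le_iff_apply_le_of_monotone hg]

/-! ### Reading a word backwards along the cycles -/

/-- The infinite word read off `x` when going backwards along the cycle of `w` through `i`,
starting just before `i`; such words are compared lexicographically. -/
def key {α : Type*} {k : ℕ} (w : Equiv.Perm α) (x : α → Fin k) (i : α) : Lex (ℕ → Fin k) :=
  toLex fun m => x ((w⁻¹ ^ (m + 1)) i)

theorem key_apply {α : Type*} {k : ℕ} (w : Equiv.Perm α) (x : α → Fin k) (i : α) (m : ℕ) :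
    key w x i m = x ((w⁻¹ ^ (m + 1)) i) := rfl

/-- The keys of a subsystem are the keys in the full system. -/
theorem key_comp {α β : Type*} {k : ℕ} {w : Equiv.Perm α} {v : Equiv.Perm β} {τ : α → β}
    (h : ∀ a, v (τ a) = τ (w a)) (x : β → Fin k) (a : α) :
    key v x (τ a) = key w (x ∘ τ) a := by
  have h1 : ∀ (m : ℕ) (a : α), (v⁻¹ ^ m) (τ a) = τ ((w⁻¹ ^ m) a) := by
    intro m
    induction m with
    | zero => intro a; rfl
    | succ m ih =>
      intro a
      have h2 : v⁻¹ (τ a) = τ (w⁻¹ a) := by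
        rw [Equiv.Perm.inv_eq_iff_eq, h, perm_apply_inv_self]
      rw [pow_succ, pow_succ, Equiv.Perm.mul_apply, Equiv.Perm.mul_apply, h2, ih]
  funext m
  rw [key_apply, key_apply, h1]
  rfl

/-- The letter at `i` is in the key of `i`, since going around the cycle leads back to `i`. -/
theorem key_apply_of_pow_eq_one {α : Type*} {k : ℕ} {w : Equiv.Perm α} (x : α → Fin k) (i : α)
    {N : ℕ} (hN : 0 < N) (h : w ^ N = 1) : key w x i (N - 1) = x i := by
  rw [key_apply, Nat.sub_add_cancel hN, inv_pow, h, inv_one, Equiv.Perm.one_apply]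

section Linear

variable {α : Type*} [LinearOrder α] {k : ℕ} {w : Equiv.Perm α} {x : α → Fin k}

/-- As long as the backward readings agree, the order of two positions is kept. -/
theorem IsStd.pow_lt_pow (h : IsStd w x) {i j : α} (hij : i < j) (m : ℕ)
    (hm : ∀ l < m, key w x i l = key w x j l) : (w⁻¹ ^ m) i < (w⁻¹ ^ m) j := by
  induction m with
  | zero => exact hij
  | succ m ih =>
    have h1 := ih fun l hl => hm l (hl.trans m.lt_succ_self)
    have h2 := hm m m.lt_succ_self
    rw [key_apply, key_apply] at h2
    have h3 := (h.lt_iff ((w⁻¹ ^ (m + 1)) i) ((w⁻¹ ^ (m + 1)) j)).1 (by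
      simpa [pow_succ', Equiv.Perm.mul_apply] using h1)
    exact (h3.resolve_left h2.not_lt).2

theorem IsStd.key_monotone (h : IsStd w x) : Monotone (key w x) := by
  refine monotone_iff_forall_lt.2 fun i j hij => le_of_not_gt fun hlt => ?_
  obtain ⟨m, hm, hlt⟩ := hlt
  have h1 := h.pow_lt_pow hij m fun l hl => (hm l hl).symm
  have h3 := h.lt_iff ((w⁻¹ ^ (m + 1)) j) ((w⁻¹ ^ (m + 1)) i)
  have h4 : w ((w⁻¹ ^ (m + 1)) j) < w ((w⁻¹ ^ (m + 1)) i) := h3.2 (.inl hlt)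
  simp only [pow_succ', Equiv.Perm.mul_apply, perm_apply_inv_self] at h4
  exact lt_asymm h1 h4

/-- Primitivity: distinct positions on one cycle have distinct keys. Otherwise moving along the
cycle by the distance of the two positions would produce a strictly increasing sequence. -/
theorem IsStd.eq_of_key_eq [Finite α] (h : IsStd w x) {i j : α} (hc : w.SameCycle i j)
    (hk : key w x i = key w x j) : i = j := by
  wlog hij : i < j generalizing i j
  · rcases lt_trichotomy i j with hl | he | hl
    · exact this hc hk hl
    · exact he
    · exact (this hc.symm hk.symm hl).symm
  obtain ⟨p, hp⟩ := (Equiv.Perm.sameCycle_inv.2 hc).exists_nat_pow_eq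
  have hlt : ∀ m, (w⁻¹ ^ m) i < (w⁻¹ ^ m) j :=
    fun m => h.pow_lt_pow hij m fun l _ => by rw [hk]
  have hmono : StrictMono fun q : ℕ => (w⁻¹ ^ (p * q)) i := strictMono_nat_of_lt_succ fun q => by
    have := hlt (p * q)
    rw [← hp, ← Equiv.Perm.mul_apply, ← pow_add] at this
    exact this
  exact absurd hmono.injective (not_injective_infinite_finite _)

end Linear

/-! ### The `k`-shuffle as the inverse of sorting a random word -/

open Classical in
/-- The words of length `n` in which the letter `a` occurs `j a` times. -/
noncomputable def wordsOfContent {k : ℕ} (n : ℕ) (j : Fin k → ℕ) : Finset (Fin n → Fin k) :=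
  Finset.univ.filter fun x => ∀ a, (Finset.univ.filter fun i => x i = a).card = j a

theorem mem_wordsOfContent {k n : ℕ} {j : Fin k → ℕ} {x : Fin n → Fin k} :
    x ∈ wordsOfContent n j ↔ ∀ a, (Finset.univ.filter fun i => x i = a).card = j a := by
  simp [wordsOfContent]

/-- The words are the terms in the expansion of a power of a sum of variables, so the multinomial
theorem counts the words of given content. -/
theorem card_wordsOfContent {k n : ℕ} {j : Fin k → ℕ} (hj : ∑ a, j a = n) :
    (wordsOfContent n j).card = Nat.multinomial Finset.univ j := by
  classical
  have h1 := Finset.sum_pow_eq_sum_piAntidiag (Finset.univ : Finset (Fin k))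
    (fun a => (MvPolynomial.X a : MvPolynomial (Fin k) ℕ)) n
  rw [Fintype.sum_pow] at h1
  -- Compare the coefficients of the monomial with exponents `j`.
  have h2 := congrArg (MvPolynomial.coeff (Finsupp.equivFunOnFinite.symm j)) h1
  have h3 : ∀ i : Fin k → ℕ, ∏ a, (MvPolynomial.X a : MvPolynomial (Fin k) ℕ) ^ i a =
      MvPolynomial.monomial (Finsupp.equivFunOnFinite.symm i) 1 := by
    intro i
    rw [MvPolynomial.monomial_eq, Finsupp.prod_fintype _ _ (by simp)]
    simp
  have h4 : ∀ x : Fin n → Fin k, ∏ i, (MvPolynomial.X (x i) : MvPolynomial (Fin k) ℕ) =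
      ∏ a, MvPolynomial.X a ^ (Finset.univ.filter fun i => x i = a).card := by
    intro x
    rw [← Finset.prod_fiberwise Finset.univ x]
    refine Finset.prod_congr rfl fun a _ => ?_
    rw [Finset.prod_congr rfl (g := fun _ => MvPolynomial.X a)
      (fun i hi => by rw [(Finset.mem_filter.1 hi).2]), Finset.prod_const]
  have h5 : ∀ (m : ℕ) (p : MvPolynomial (Fin k) ℕ),
      MvPolynomial.coeff (Finsupp.equivFunOnFinite.symm j) ((m : MvPolynomial (Fin k) ℕ) * p) =
      m * MvPolynomial.coeff (Finsupp.equivFunOnFinite.symm j) p := by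
    intro m p
    rw [← nsmul_eq_mul, MvPolynomial.coeff_smul, smul_eq_mul]
  simp only [MvPolynomial.coeff_sum, h3, h4, MvPolynomial.coeff_monomial, h5,
    EmbeddingLike.apply_eq_iff_eq] at h2
  simp only [mul_ite, mul_one, mul_zero] at h2
  rw [Finset.sum_ite_eq' (Finset.piAntidiag Finset.univ n) j, if_pos (by simpa using hj)] at h2
  rw [← h2, wordsOfContent, Finset.card_filter]
  exact Finset.sum_congr rfl fun x _ => if_congr funext_iff.symm rfl rfl

theorem card_filter_comp_perm {n : ℕ} {α : Type*} (x : Fin n → α) (σ : Equiv.Perm (Fin n))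
    (p : α → Prop) [DecidablePred p] :
    (Finset.univ.filter fun i => p (x (σ i))).card = (Finset.univ.filter fun i => p (x i)).card :=
  Finset.card_equiv σ (by simp)

theorem card_filter_mem_of_mem_wordsOfContent {k n : ℕ} {j : Fin k → ℕ} {x : Fin n → Fin k}
    (hx : x ∈ wordsOfContent n j) (s : Finset (Fin k)) :
    (Finset.univ.filter fun i => x i ∈ s).card = ∑ b ∈ s, j b := by
  rw [Finset.card_eq_sum_card_fiberwise (f := x) (t := s) (by
    intro i hi
    simpa using hi)]
  refine Finset.sum_congr rfl fun b hb => ?_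
  rw [← mem_wordsOfContent.1 hx b, Finset.filter_filter]
  refine congrArg _ (Finset.filter_congr fun i _ => ?_)
  exact ⟨fun h => h.2, fun h => ⟨h ▸ hb, h⟩⟩

/-- Sorting a word of content `j` produces the word whose letter at `c` is the pile of `c`. -/
theorem comp_sort_eq_iff {k n : ℕ} {j : Fin k → ℕ} {x : Fin n → Fin k}
    (hx : x ∈ wordsOfContent n j) (c : Fin n) (a : Fin k) :
    x (Tuple.sort x c) = a ↔ c ∈ pile n j a := by
  have hm := Tuple.monotone_sort x
  have h1 := Tuple.lt_card_le_iff_apply_le_of_monotone hm (j := c) (a := a)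
  have h2 := Tuple.lt_card_lt_iff_apply_lt_of_monotone hm (j := c) (a := a)
  simp only [Function.comp_apply] at h1 h2
  rw [card_filter_comp_perm x _ (· ≤ a)] at h1
  rw [card_filter_comp_perm x _ (· < a)] at h2
  have h3 := card_filter_mem_of_mem_wordsOfContent hx (Finset.Iic a)
  have h4 := card_filter_mem_of_mem_wordsOfContent hx (Finset.Iio a)
  simp only [Finset.mem_Iic, Finset.mem_Iio] at h3 h4
  rw [h3] at h1
  rw [h4] at h2
  simp only [pile, Finset.mem_filter, Finset.mem_univ, true_and]
  rw [← not_lt, h2, h1, not_lt, and_comm, le_antisymm_iff]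

theorem std_mem_interleavings {k n : ℕ} {j : Fin k → ℕ} {x : Fin n → Fin k}
    (hx : x ∈ wordsOfContent n j) : std x ∈ interleavings n j := by
  simp only [interleavings, Finset.mem_filter, Finset.mem_univ, true_and]
  intro a c hc d hd hcd
  rw [Finset.mem_coe, ← comp_sort_eq_iff hx] at hc hd
  exact (Tuple.eq_sort_iff.1 (rfl : Tuple.sort x = Tuple.sort x)).2 c d hcd (hc.trans hd.symm)

theorem std_injOn {k n : ℕ} (j : Fin k → ℕ) :
    Set.InjOn (std : (Fin n → Fin k) → _) (wordsOfContent n j : Set (Fin n → Fin k)) := by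
  intro x hx y hy hxy
  have h : Tuple.sort x = Tuple.sort y := inv_injective hxy
  funext i
  obtain ⟨c, rfl⟩ := (Tuple.sort x).surjective i
  have h1 := (comp_sort_eq_iff hx c _).1 rfl
  rw [← comp_sort_eq_iff hy, ← h] at h1
  exact h1.symm

theorem exists_std_eq_of_mem_interleavings {k n : ℕ} {j : Fin k → ℕ} (hj : ∑ a, j a = n)
    {w : Equiv.Perm (Fin n)} (hw : w ∈ interleavings n j) :
    ∃ x ∈ wordsOfContent n j, std x = w := by
  -- Sorting any word of the right content gives the letters of the piles.
  obtain ⟨y, hy⟩ : (wordsOfContent n j).Nonempty := by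
    rw [← Finset.card_pos, card_wordsOfContent hj]
    exact Nat.multinomial_pos _ _
  refine ⟨fun i => y (Tuple.sort y (w i)), ?_, ?_⟩
  · rw [mem_wordsOfContent] at hy ⊢
    intro a
    rw [← hy a]
    exact card_filter_comp_perm y (w.trans (Tuple.sort y)) (· = a)
  · rw [std_eq_iff]
    rintro i i' (hl | ⟨he, hl⟩)
    · by_contra! hc
      exact absurd hl (Tuple.monotone_sort y hc).not_gt
    · simp only [interleavings, Finset.mem_filter, Finset.mem_univ, true_and] at hw
      refine ((hw (y (Tuple.sort y (w i')))).lt_iff_lt (a := w i) (b := w i') ?_ ?_).1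
        (by simpa using hl)
      · rw [Finset.mem_coe, ← comp_sort_eq_iff hy]
        exact he
      · rw [Finset.mem_coe, ← comp_sort_eq_iff hy]

open Classical in
theorem card_interleavings_filter {k n : ℕ} {j : Fin k → ℕ} (hj : ∑ a, j a = n)
    (A : Set (Equiv.Perm (Fin n))) :
    ((interleavings n j).filter (· ∈ A)).card =
      ((wordsOfContent n j).filter fun x => std x ∈ A).card := by
  refine (Finset.card_bij (fun x _ => std x) ?_ ?_ ?_).symm
  · intro x hx
    rw [Finset.mem_filter] at hx ⊢
    exact ⟨std_mem_interleavings hx.1, hx.2⟩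
  · intro x hx y hy h
    exact std_injOn j (Finset.mem_filter.1 hx).1 (Finset.mem_filter.1 hy).1 h
  · intro w hw
    rw [Finset.mem_filter] at hw
    obtain ⟨x, hx, rfl⟩ := exists_std_eq_of_mem_interleavings hj hw.1
    exact ⟨x, Finset.mem_filter.2 ⟨hx, hw.2⟩, rfl⟩

theorem card_interleavings {k n : ℕ} {j : Fin k → ℕ} (hj : ∑ a, j a = n) :
    (interleavings n j).card = Nat.multinomial Finset.univ j := by
  classical
  have := card_interleavings_filter hj Set.univ
  simpa [card_wordsOfContent hj] using this

open Classical in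
/-- The `k`-shuffle is the standardization of a uniformly random word. -/
theorem kShuffle_toOuterMeasure (k n : ℕ) (hk : 0 < k) (A : Set (Equiv.Perm (Fin n))) :
    (kShuffle k n hk).toOuterMeasure A =
      ((Finset.univ.filter fun x : Fin n → Fin k => std x ∈ A).card : ℝ≥0∞) / (k : ℝ≥0∞) ^ n := by
  rw [kShuffle, PMF.toOuterMeasure_bind_apply,
    tsum_eq_sum (s := Finset.piAntidiag Finset.univ n)]
  · have h1 : (Finset.univ.filter fun x : Fin n → Fin k => std x ∈ A).card =
        ∑ j ∈ Finset.piAntidiag (Finset.univ : Finset (Fin k)) n,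
          ((wordsOfContent n j).filter fun x => std x ∈ A).card := by
      rw [Finset.card_eq_sum_card_fiberwise
        (f := fun (x : Fin n → Fin k) a => (Finset.univ.filter fun i => x i = a).card)
        (t := Finset.piAntidiag Finset.univ n)]
      · refine Finset.sum_congr rfl fun j _ => congrArg _ ?_
        ext x
        simp only [Finset.mem_filter, Finset.mem_univ, true_and, mem_wordsOfContent, funext_iff]
        exact and_comm
      · intro x _
        simp only [Finset.mem_coe, Finset.mem_piAntidiag, Finset.mem_univ, implies_true, and_true]
        simpa using (Finset.card_eq_sum_card_fiberwise (f := x) (s := Finset.univ)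
          (t := Finset.univ) (by simp)).symm
    rw [h1, Nat.cast_sum, div_eq_mul_inv, Finset.sum_mul]
    refine Finset.sum_congr rfl fun j hj => ?_
    have hj' : ∑ a, j a = n := (Finset.mem_piAntidiag.1 hj).1
    rw [PMF.toOuterMeasure_uniformOfFinset_apply, card_interleavings_filter hj',
      card_interleavings hj']
    simp only [pileSizes, PMF.ofFinset_apply, if_pos hj']
    have h0 : (Nat.multinomial Finset.univ j : ℝ≥0∞) ≠ 0 := by
      exact_mod_cast (Nat.multinomial_pos _ _).ne'
    rw [div_eq_mul_inv, div_eq_mul_inv, mul_mul_mul_comm, mul_right_comm,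
      ← mul_assoc, mul_comm (_ * _ : ℝ≥0∞) (_ : ℝ≥0∞)⁻¹, ← mul_assoc,
      ENNReal.inv_mul_cancel h0 (ENNReal.natCast_ne_top _), one_mul, mul_comm]
  · intro j hj
    have hj' : ¬ ∑ a, j a = n := fun h => hj (by simpa using h)
    simp [pileSizes, hj']

/-! ### The number of words with given standardization -/

/-- The number of ascents of `u` at the positions before `i`; the last position `m - 1` is not
counted. -/
noncomputable def numAscentsBefore {m : ℕ} (u : Equiv.Perm (Fin m)) (i : ℕ) : ℕ :=
  ((Finset.range i).filter fun l => ∃ h : l + 1 < m, u ⟨l, by omega⟩ < u ⟨l + 1, h⟩).card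

theorem numAscentsBefore_le {m : ℕ} (u : Equiv.Perm (Fin m)) (i : ℕ) :
    numAscentsBefore u i ≤ i :=
  (Finset.card_filter_le _ _).trans_eq (Finset.card_range i)

open Classical in
theorem numAscentsBefore_succ {m : ℕ} (u : Equiv.Perm (Fin m)) (i : ℕ) (h : i + 1 < m) :
    numAscentsBefore u (i + 1) =
      numAscentsBefore u i + if u ⟨i, by omega⟩ < u ⟨i + 1, h⟩ then 1 else 0 := by
  unfold numAscentsBefore
  rw [Finset.range_add_one, Finset.filter_insert]
  by_cases hlt : u ⟨i, by omega⟩ < u ⟨i + 1, h⟩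
  · rw [if_pos ⟨h, hlt⟩, if_pos hlt, Finset.card_insert_of_notMem (by simp)]
  · rw [if_neg (by rintro ⟨_, h'⟩; exact hlt h'), if_neg hlt, add_zero]

theorem numAscentsBefore_add_numDescents {m : ℕ} (u : Equiv.Perm (Fin (m + 1))) :
    numAscentsBefore u m + numDescents u = m := by
  classical
  have h1 : numDescents u = ((Finset.range m).filter fun l =>
      ¬ ∃ h : l + 1 < m + 1, u ⟨l, by omega⟩ < u ⟨l + 1, h⟩).card := by
    rw [numDescents, Nat.card_eq_fintype_card, Fintype.card_subtype]
    refine Finset.card_bij (fun i _ => (i : ℕ)) ?_ ?_ ?_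
    · intro i hi
      obtain ⟨h, hlt⟩ := (Finset.mem_filter.1 hi).2
      rw [Finset.mem_filter, Finset.mem_range]
      refine ⟨by omega, ?_⟩
      rintro ⟨_, h'⟩
      exact lt_asymm hlt h'
    · intro i _ i' _ h
      exact Fin.ext h
    · intro l hl
      rw [Finset.mem_filter, Finset.mem_range] at hl
      refine ⟨⟨l, by omega⟩, ?_, rfl⟩
      rw [Finset.mem_filter]
      refine ⟨Finset.mem_univ _, by simpa using hl.1, ?_⟩
      have h2 : ¬ u ⟨l, by omega⟩ < u ⟨l + 1, by omega⟩ := fun h => hl.2 ⟨by omega, h⟩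
      refine lt_of_le_of_ne (not_lt.1 h2) (u.injective.ne ?_)
      simp [Fin.ext_iff]
  rw [h1, numAscentsBefore, Finset.card_filter_add_card_filter_not, Finset.card_range]

/-- A word has standardization `s` when, read in the order `u = s⁻¹`, it is weakly increasing, and
strictly increasing at the descents of `u`. -/
theorem std_eq_inv_iff {m k : ℕ} (u : Equiv.Perm (Fin (m + 1))) (y : Fin (m + 1) → Fin k) :
    std y = u⁻¹ ↔ ∀ i : Fin m, y (u i.castSucc) < y (u i.succ) ∨
      y (u i.castSucc) = y (u i.succ) ∧ u i.castSucc < u i.succ := by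
  have h1 : std y = u⁻¹ ↔ StrictMono fun i => toLex (y (u i), u i) := by
    rw [std, inv_inj, eq_comm, Tuple.eq_sort_iff]
    constructor
    · rintro ⟨h1, h2⟩ i j hij
      rw [Prod.Lex.toLex_lt_toLex]
      rcases (h1 hij.le).eq_or_lt with he | hl
      · exact .inr ⟨he, h2 i j hij he⟩
      · exact .inl hl
    · intro h
      refine ⟨monotone_iff_forall_lt.2 fun i j hij => ?_, fun i j hij he => ?_⟩
      · rcases Prod.Lex.toLex_lt_toLex.1 (h hij) with hl | ⟨he, _⟩
        exacts [hl.le, he.le]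
      · rcases Prod.Lex.toLex_lt_toLex.1 (h hij) with hl | ⟨_, hl⟩
        exacts [absurd he hl.ne, hl]
  rw [h1, Fin.strictMono_iff_lt_succ]
  simp only [Prod.Lex.toLex_lt_toLex]

/-- The number of words with a given standardization. Adding to the `i`-th smallest letter the
number of ascents before `i` turns the words into strictly increasing sequences. -/
theorem card_std_eq (m k : ℕ) (hm : 0 < m) (hk : 0 < k) (s : Equiv.Perm (Fin m)) :
    Nat.card {y : Fin m → Fin k // std y = s} =
      (m + k - numDescents s⁻¹ - 1).choose m := by
  obtain ⟨m, rfl⟩ : ∃ l, m = l + 1 := ⟨m - 1, by omega⟩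
  obtain ⟨u, rfl⟩ : ∃ u : Equiv.Perm (Fin (m + 1)), s = u⁻¹ := ⟨s⁻¹, (inv_inv s).symm⟩
  rw [inv_inv]
  set e := numAscentsBefore u with he
  have hed : e m + numDescents u = m := numAscentsBefore_add_numDescents u
  have hN : m + 1 + k - numDescents u - 1 = k + e m := by omega
  have hmono : Monotone e := by
    intro a b hab
    exact Finset.card_le_card (Finset.filter_subset_filter _ (Finset.range_mono hab))
  have hle : ∀ i, e i ≤ i := numAscentsBefore_le u
  have hstep : ∀ i : Fin m, e (i + 1) =
      e i + if u i.castSucc < u i.succ then 1 else 0 := by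
    intro i
    exact numAscentsBefore_succ u i (by omega)
  rw [hN]
  have hcard : Nat.card (Fin (m + 1) ↪o Fin (k + e m)) = (k + e m).choose (m + 1) := by
    rw [Nat.card_congr Set.powersetCard.ofFinEmbEquiv, Set.powersetCard.card, Nat.card_fin]
  rw [← hcard]
  let up : {y : Fin (m + 1) → Fin k // std y = u⁻¹} → (Fin (m + 1) ↪o Fin (k + e m)) := fun y =>
    OrderEmbedding.ofStrictMono
      (fun i => ⟨y.1 (u i) + e i, by
        have := hmono (Nat.lt_succ_iff.1 i.2)
        have := (y.1 (u i)).2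
        omega⟩)
      (Fin.strictMono_iff_lt_succ.2 fun i => by
        have h1 := (std_eq_inv_iff u y.1).1 y.2 i
        have h2 := hstep i
        rw [Fin.lt_def]
        simp only [Fin.val_castSucc, Fin.val_succ]
        rcases h1 with h1 | ⟨h1, h3⟩
        · rw [Fin.lt_def] at h1
          omega
        · rw [if_pos h3] at h2
          rw [h1]
          omega)
  refine Nat.card_congr (Equiv.ofBijective up ⟨fun y y' h => ?_, fun f => ?_⟩)
  · refine Subtype.ext (funext fun j => Fin.ext ?_)
    obtain ⟨i, rfl⟩ := u.surjective j
    have := congrArg Fin.val (DFunLike.congr_fun h i)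
    simpa [up] using this
  · have hf1 : ∀ i : Fin m, (f i.castSucc : ℕ) < f i.succ := fun i =>
      f.strictMono i.castSucc_lt_succ
    have hf2 : ∀ i : Fin (m + 1), e i ≤ f i := by
      intro i
      induction i using Fin.induction with
      | zero => exact (hle 0).trans (Nat.zero_le _)
      | succ i ih =>
        have := hf1 i
        have h2 := hstep i
        simp only [Fin.val_castSucc, Fin.val_succ] at ih ⊢
        split_ifs at h2 <;> omega
    -- The sequence `f i - e i` is weakly increasing, so its last term is the largest.
    have hmono' : Monotone fun i : Fin (m + 1) => (f i : ℕ) - e i := by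
      refine Fin.monotone_iff_le_succ.2 fun i => ?_
      have := hf1 i
      have h2 := hstep i
      simp only [Fin.val_castSucc, Fin.val_succ]
      split_ifs at h2 <;> omega
    have hlt : ∀ i : Fin (m + 1), (f i : ℕ) - e i < k := by
      intro i
      refine (hmono' (Fin.le_last i)).trans_lt ?_
      have := (f (Fin.last m)).2
      have := hf2 (Fin.last m)
      simp only [Fin.val_last] at *
      omega
    refine ⟨⟨fun j => ⟨f (u⁻¹ j) - e (u⁻¹ j : Fin (m + 1)), hlt _⟩, ?_⟩, ?_⟩
    · rw [std_eq_inv_iff]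
      intro i
      simp only [perm_inv_apply_self, Fin.lt_def, Fin.ext_iff]
      have := hf1 i
      have h2 := hstep i
      have h3 := hf2 i.castSucc
      simp only [Fin.lt_def] at h2
      simp only [Fin.val_castSucc, Fin.val_succ] at *
      split_ifs at h2 with h4
      · by_cases h5 : (f i.castSucc : ℕ) - e i < f i.succ - e (i + 1)
        · exact .inl h5
        · exact .inr ⟨by omega, h4⟩
      · exact .inl (by omega)
    · refine DFunLike.ext _ _ fun i => Fin.ext ?_
      have := hf2 i
      simp only [up, OrderEmbedding.coe_ofStrictMono, perm_inv_apply_self]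
      omega

/-! ### The words along the cycles -/

section Supports

variable {n : ℕ} {w : Equiv.Perm (Fin n)}

theorem mem_cycleSupports {O : Finset (Fin n)} :
    O ∈ cycleSupports w ↔ ∃ i, ∀ j, j ∈ O ↔ w.SameCycle i j := by
  simp only [cycleSupports, Finset.mem_image, Finset.mem_univ, true_and, Finset.ext_iff,
    Finset.mem_filter]
  exact exists_congr fun i => forall_congr' fun j => Iff.comm

theorem sameCycle_of_mem_cycleSupports {O : Finset (Fin n)} (hO : O ∈ cycleSupports w) {i j : Fin n}
    (hi : i ∈ O) : j ∈ O ↔ w.SameCycle i j := by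
  obtain ⟨l, hl⟩ := mem_cycleSupports.1 hO
  rw [hl]
  exact ⟨((hl i).1 hi).symm.trans, ((hl i).1 hi).trans⟩

theorem pairwiseDisjoint_cycleSupports :
    (cycleSupports w : Set (Finset (Fin n))).PairwiseDisjoint id := by
  intro O hO O' hO' hne
  rw [Function.onFun, Finset.disjoint_left]
  intro i hi hi'
  exact hne (Finset.ext fun j => by
    rw [sameCycle_of_mem_cycleSupports hO hi, sameCycle_of_mem_cycleSupports hO' hi'])

theorem biUnion_cycleSupports : (cycleSupports w).biUnion id = Finset.univ := by
  classical
  refine Finset.eq_univ_of_forall fun i => Finset.mem_biUnion.2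
    ⟨Finset.univ.filter fun j => w.SameCycle i j, mem_cycleSupports.2 ⟨i, by simp⟩, ?_⟩
  simpa using Equiv.Perm.SameCycle.refl w i

theorem exists_hasShape {O : Finset (Fin n)} (hO : O ∈ cycleSupports w) : ∃ s, HasShape w O s := by
  obtain ⟨i₀, hi₀⟩ := mem_cycleSupports.1 hO
  have hmem : i₀ ∈ O := (hi₀ i₀).2 (.refl w i₀)
  have hw : ∀ i, w i ∈ O ↔ i ∈ O := fun i => by
    rw [hi₀, hi₀, Equiv.Perm.sameCycle_apply_right]
  let τ : Fin O.card ≃o O := O.orderIsoOfFin rfl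
  let v : Equiv.Perm (Fin O.card) := τ.symm.toEquiv.permCongr (w.subtypePerm hw)
  have hv : ∀ a, w (τ a : Fin n) = (τ (v a) : Fin n) := fun a => by
    simp [v, Equiv.permCongr_apply, τ]
  have hpow : ∀ (m : ℕ) (a), (w ^ m) (τ a : Fin n) = (τ ((v ^ m) a) : Fin n) := by
    intro m
    induction m with
    | zero => intro a; rfl
    | succ m ih =>
      intro a
      rw [pow_succ, pow_succ, Equiv.Perm.mul_apply, Equiv.Perm.mul_apply, hv, ih]
  refine ⟨⟨O.card, Finset.card_pos.2 ⟨i₀, hmem⟩, v, fun a b => ?_⟩, τ, hv⟩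
  have h : w.SameCycle (τ a : Fin n) (τ b : Fin n) :=
    (sameCycle_of_mem_cycleSupports hO (τ a).2).1 (τ b).2
  obtain ⟨m, hm⟩ := h.exists_nat_pow_eq
  rw [hpow] at hm
  exact ⟨m, τ.injective (Subtype.ext (by simpa using hm))⟩

theorem HasShape.unique {O : Finset (Fin n)} {s s' : CycleShape} (h : HasShape w O s)
    (h' : HasShape w O s') : s = s' := by
  obtain ⟨m, hm, v, hv⟩ := s
  obtain ⟨m', hm', v', hv'⟩ := s'
  obtain ⟨τ, hτ⟩ := h
  obtain ⟨τ', hτ'⟩ := h'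
  dsimp only at τ τ' hτ hτ'
  obtain rfl : m = m' := by
    simpa using Fintype.card_congr (τ.toEquiv.trans τ'.symm.toEquiv)
  obtain rfl : τ = τ' := Subsingleton.elim _ _
  obtain rfl : v = v' := Equiv.ext fun a => τ.injective (Subtype.ext (by rw [← hτ, hτ']))
  rfl

end Supports

open Classical in
/-- The supports of the cycles of `w` of shape `s`. -/
noncomputable def cyclesOfShape {n : ℕ} (w : Equiv.Perm (Fin n)) (s : CycleShape) :
    Finset (Finset (Fin n)) :=
  (cycleSupports w).filter fun O => HasShape w O s

theorem mem_cyclesOfShape {n : ℕ} {w : Equiv.Perm (Fin n)} {s : CycleShape}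
    {O : Finset (Fin n)} : O ∈ cyclesOfShape w s ↔ O ∈ cycleSupports w ∧ HasShape w O s := by
  simp [cyclesOfShape]

/-- The subword of `x` at the positions of a cycle. -/
noncomputable def HasShape.word {n k : ℕ} {w : Equiv.Perm (Fin n)} {s : CycleShape}
    {O : Finset (Fin n)} (h : HasShape w O s) (x : Fin n → Fin k) : Fin s.size → Fin k :=
  fun a => x (h.choose a)

theorem HasShape.word_apply {n k : ℕ} {w : Equiv.Perm (Fin n)} {s : CycleShape}
    {O : Finset (Fin n)} (h : HasShape w O s) (x : Fin n → Fin k) (τ : Fin s.size ≃o O)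
    (a : Fin s.size) : h.word x a = x (τ a) := by
  rw [HasShape.word, Subsingleton.elim h.choose τ]

theorem HasShape.std_word {n k : ℕ} {x : Fin n → Fin k} {s : CycleShape}
    {O : Finset (Fin n)} (h : HasShape (std x) O s) : std (h.word x) = s.perm := by
  rw [std_eq_iff]
  obtain ⟨τ, hτ⟩ := id h
  intro a b hab
  rw [h.word_apply x τ, h.word_apply x τ] at hab
  have h1 := isStd_std x (τ a) (τ b) (by simpa using hab)
  rw [hτ, hτ] at h1
  simpa using h1

/-- The multiset of the subwords of `x` at the cycles of shape `s` of its standardization. -/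
noncomputable def cycleWords {n k : ℕ} (x : Fin n → Fin k) (s : CycleShape) :
    Multiset {y : Fin s.size → Fin k // std y = s.perm} :=
  (Finset.univ : Finset {O // O ∈ cyclesOfShape (std x) s}).val.map fun O =>
    ⟨(mem_cyclesOfShape.1 O.2).2.word x, (mem_cyclesOfShape.1 O.2).2.std_word⟩

theorem card_cycleWords {n k : ℕ} (x : Fin n → Fin k) (s : CycleShape) :
    (cycleWords x s).card = numCyclesOfShape (std x) s := by
  rw [cycleWords, Multiset.card_map]
  exact Fintype.card_coe (cyclesOfShape (std x) s)

/-- The multiset of the keys of a word, tested by sums of functions `f`, is determined by its cycle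
words. -/
theorem sum_key_eq {n k : ℕ} (x : Fin n → Fin k) (ns : CycleShape →₀ ℕ)
    (hx : ∀ s, numCyclesOfShape (std x) s = ns s) (f : Lex (ℕ → Fin k) → ℕ) :
    ∑ i, f (key (std x) x i) =
      ∑ s ∈ ns.support, ((cycleWords x s).map fun y => ∑ a, f (key s.perm y.1 a)).sum := by
  classical
  have h1 : cycleSupports (std x) = ns.support.biUnion (cyclesOfShape (std x)) := by
    ext O
    simp only [Finset.mem_biUnion, mem_cyclesOfShape]
    refine ⟨fun hO => ?_, fun ⟨_, _, hO, _⟩ => hO⟩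
    obtain ⟨s, hs⟩ := exists_hasShape hO
    refine ⟨s, ?_, hO, hs⟩
    rw [Finsupp.mem_support_iff, ← hx s]
    exact (Finset.card_pos.2 ⟨O, mem_cyclesOfShape.2 ⟨hO, hs⟩⟩ : 0 < (cyclesOfShape _ s).card).ne'
  rw [← biUnion_cycleSupports (w := std x), Finset.sum_biUnion pairwiseDisjoint_cycleSupports, h1,
    Finset.sum_biUnion]
  · refine Finset.sum_congr rfl fun s _ => ?_
    rw [cycleWords, Multiset.map_map, ← Finset.sum_coe_sort]
    refine Finset.sum_congr rfl fun O _ => ?_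
    have hO := (mem_cyclesOfShape.1 O.2).2
    obtain ⟨τ, hτ⟩ := id hO
    have hword : hO.word x = x ∘ fun a => (τ a : Fin n) := funext fun a => hO.word_apply x τ a
    rw [id, ← Finset.sum_coe_sort, ← Equiv.sum_comp τ.toEquiv]
    refine Finset.sum_congr rfl fun a _ => congrArg f ?_
    simp only [hword]
    exact key_comp hτ x a
  · intro s _ s' _ hne
    rw [Function.onFun, Finset.disjoint_left]
    intro O hO hO'
    exact hne ((mem_cyclesOfShape.1 hO).2.unique (mem_cyclesOfShape.1 hO').2)

/-- A word is determined by its cycle words: these determine the multiset of the keys, hence the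
keys, which increase weakly with the position, and the keys contain the letters. -/
theorem eq_of_cycleWords_eq {n k : ℕ} {x x' : Fin n → Fin k} (ns : CycleShape →₀ ℕ)
    (hx : ∀ s, numCyclesOfShape (std x) s = ns s) (hx' : ∀ s, numCyclesOfShape (std x') s = ns s)
    (h : ∀ s ∈ ns.support, cycleWords x s = cycleWords x' s) : x = x' := by
  have hkey : key (std x) x = key (std x') x' := by
    refine eq_of_monotone_of_card_le_eq (isStd_std x).key_monotone (isStd_std x').key_monotone
      fun a => ?_
    rw [Finset.card_filter, Finset.card_filter,
      sum_key_eq x ns hx fun κ => if κ ≤ a then 1 else 0,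
      sum_key_eq x' ns hx' fun κ => if κ ≤ a then 1 else 0]
    exact Finset.sum_congr rfl fun s hs => by rw [h s hs]
  funext i
  -- A common multiple of the orders reads the letter at the same place of both keys.
  have hN : 0 < orderOf (std x) * orderOf (std x') := mul_pos (orderOf_pos _) (orderOf_pos _)
  rw [← key_apply_of_pow_eq_one x i hN (by rw [pow_mul, pow_orderOf_eq_one, one_pow]), hkey,
    key_apply_of_pow_eq_one x' i hN (by rw [mul_comm, pow_mul, pow_orderOf_eq_one, one_pow])]

/-! ### Assembling a word from its cycle words -/

section Key

variable {α : Type*} {k : ℕ} {w : Equiv.Perm α} {x : α → Fin k} {i j : α}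

theorem key_map_zero (w : Equiv.Perm α) (x : α → Fin k) (i : α) : key w x (w i) 0 = x i := by
  rw [key_apply, zero_add, pow_one, perm_inv_apply_self]

theorem key_map_succ (w : Equiv.Perm α) (x : α → Fin k) (i : α) (m : ℕ) :
    key w x (w i) (m + 1) = key w x i m := by
  rw [key_apply, key_apply, pow_succ _ (m + 1), Equiv.Perm.mul_apply, perm_inv_apply_self]

theorem key_map_lt_of_lt (h : x i < x j) : key w x (w i) < key w x (w j) :=
  ⟨0, fun _ hl => absurd hl (Nat.not_lt_zero _), by
    rwa [key_map_zero, key_map_zero]⟩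

theorem key_map_lt_of_key_lt (h : x i = x j) (hk : key w x i < key w x j) :
    key w x (w i) < key w x (w j) := by
  obtain ⟨m, hm, hlt⟩ := hk
  refine ⟨m + 1, fun l hl => ?_, ?_⟩
  · cases l with
    | zero => rw [key_map_zero, key_map_zero, h]
    | succ l =>
      rw [key_map_succ, key_map_succ]
      exact hm l (Nat.lt_of_succ_lt_succ hl)
  · rw [key_map_succ, key_map_succ]
    exact hlt

theorem key_map_congr (h : x i = x j) (hk : key w x i = key w x j) :
    key w x (w i) = key w x (w j) := by
  funext m
  cases m with
  | zero => rw [key_map_zero, key_map_zero, h]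
  | succ m => rw [key_map_succ, key_map_succ, hk]

end Key

theorem exists_equiv_fin_lt_iff {E L : Type*} [Fintype E] [LinearOrder L] {n : ℕ} (r : E → L)
    (hr : Function.Injective r) (hE : Fintype.card E = n) :
    ∃ ψ : E ≃ Fin n, ∀ e e', ψ e < ψ e' ↔ r e < r e' := by
  let _ : LinearOrder E := LinearOrder.lift' r hr
  exact ⟨(Fintype.orderIsoFinOfCardEq E hE).symm.toEquiv, fun e e' =>
    (Fintype.orderIsoFinOfCardEq E hE).symm.lt_iff_lt⟩

/-- The positions in a disjoint union of cycles, `ns s` of them of shape `s`. -/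
abbrev CyclePositions (ns : CycleShape →₀ ℕ) : Type :=
  Σ s : ns.support, Fin (ns s.1) × Fin s.1.size

theorem card_cyclePositions (ns : CycleShape →₀ ℕ) :
    Fintype.card (CyclePositions ns) = ns.sum fun s m => s.size * m := by
  rw [Fintype.card_sigma, Finsupp.sum,
    ← Finset.sum_coe_sort ns.support fun s => s.size * ns s]
  exact Finset.sum_congr rfl fun s _ => by
    rw [Fintype.card_prod, Fintype.card_fin, Fintype.card_fin, mul_comm]

/-- Any family of words on the cycles can be assembled to one word: order the positions by their
keys, and break ties by an arbitrary numbering of the cycles. -/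
theorem exists_assembly {k n : ℕ} (ns : CycleShape →₀ ℕ)
    (hn : (ns.sum fun s m => s.size * m) = n)
    (y : ∀ s : ns.support, Fin (ns s.1) → {y : Fin s.1.size → Fin k // std y = s.1.perm}) :
    ∃ (x : Fin n → Fin k) (ψ : CyclePositions ns ≃ Fin n),
      (∀ s t a, x (ψ ⟨s, t, a⟩) = (y s t).1 a) ∧
      (∀ s t a, std x (ψ ⟨s, t, a⟩) = ψ ⟨s, t, s.1.perm a⟩) ∧
      ∀ s t, StrictMono fun a => ψ ⟨s, t, a⟩ := by
  let W : Equiv.Perm (CyclePositions ns) :=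
    Equiv.sigmaCongrRight fun s => Equiv.prodCongr (Equiv.refl _) s.1.perm
  let X : CyclePositions ns → Fin k := fun e => (y e.1 e.2.1).1 e.2.2
  let g : CyclePositions ns → ℕ := fun e =>
    (Fintype.equivFin (Σ s : ns.support, Fin (ns s.1)) ⟨e.1, e.2.1⟩ : ℕ)
  -- Within a cycle the keys are distinct, so the pair of key and cycle determines the position.
  let r : CyclePositions ns → Lex (ℕ → Fin k) ×ₗ ℕ := fun e => toLex (key W X e, g e)
  have hstd : ∀ s t, IsStd s.1.perm (y s t).1 := fun s t => std_eq_iff.1 (y s t).2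
  have hkey : ∀ s t a, key W X ⟨s, t, a⟩ = key s.1.perm (y s t).1 a := fun s t a =>
    key_comp (w := s.1.perm) (v := W) (τ := fun a => (⟨s, t, a⟩ : CyclePositions ns))
      (fun _ => rfl) X a
  have hr : Function.Injective r := by
    rintro ⟨s, t, a⟩ ⟨s', t', a'⟩ h
    obtain ⟨h1, h2⟩ := Prod.ext_iff.1 (toLex.injective h)
    have h3 := (Fintype.equivFin _).injective (Fin.ext h2)
    obtain ⟨rfl, h4⟩ := Sigma.mk.inj_iff.1 h3
    obtain rfl := eq_of_heq h4
    change key W X _ = key W X _ at h1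
    rw [hkey, hkey] at h1
    rw [(hstd s t).eq_of_key_eq (s.1.transitive a a') h1]
  obtain ⟨ψ, hψ⟩ := exists_equiv_fin_lt_iff r hr ((card_cyclePositions ns).trans hn)
  have hWr : ∀ e e', (X e < X e' ∨ X e = X e' ∧ r e < r e') → r (W e) < r (W e') := by
    rintro e e' (h | ⟨h, hlt⟩)
    · exact Prod.Lex.toLex_lt_toLex.2 (.inl (key_map_lt_of_lt h))
    · rcases Prod.Lex.toLex_lt_toLex.1 hlt with hl | ⟨he, hl⟩
      · exact Prod.Lex.toLex_lt_toLex.2 (.inl (key_map_lt_of_key_lt h hl))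
      · exact Prod.Lex.toLex_lt_toLex.2 (.inr ⟨key_map_congr h he, hl⟩)
  have hw : std (X ∘ ψ.symm) = ψ.permCongr W := by
    rw [std_eq_iff]
    intro i j hij
    obtain ⟨e, rfl⟩ := ψ.surjective i
    obtain ⟨e', rfl⟩ := ψ.surjective j
    simp only [Function.comp_apply, Equiv.symm_apply_apply, hψ] at hij
    simp only [Equiv.permCongr_apply, Equiv.symm_apply_apply, hψ]
    exact hWr e e' hij
  refine ⟨X ∘ ψ.symm, ψ, fun s t a => ?_, fun s t a => ?_, fun s t a b hab => ?_⟩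
  · rw [Function.comp_apply, Equiv.symm_apply_apply]
  · rw [hw, Equiv.permCongr_apply, Equiv.symm_apply_apply]
    rfl
  · rw [hψ]
    refine Prod.Lex.toLex_lt_toLex.2 (.inl ?_)
    rw [hkey, hkey]
    refine lt_of_le_of_ne ((hstd s t).key_monotone hab.le) fun h => hab.ne ?_
    exact (hstd s t).eq_of_key_eq (s.1.transitive a b) h

section Assembly

variable {k n : ℕ} {ns : CycleShape →₀ ℕ} {w : Equiv.Perm (Fin n)} {ψ : CyclePositions ns ≃ Fin n}

/-- The set of positions of one of the cycles in an assembly. -/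
def cycleRange (ψ : CyclePositions ns ≃ Fin n) (s : ns.support) (t : Fin (ns s.1)) :
    Finset (Fin n) :=
  Finset.univ.image fun a => ψ ⟨s, t, a⟩

theorem mem_cycleRange {s : ns.support} {t : Fin (ns s.1)} {i : Fin n} :
    i ∈ cycleRange ψ s t ↔ ∃ a, ψ ⟨s, t, a⟩ = i := by
  simp [cycleRange]

theorem cycleRange_injective (s : ns.support) : Function.Injective (cycleRange ψ s) := by
  intro t t' h
  have h1 : ψ ⟨s, t, ⟨0, s.1.size_pos⟩⟩ ∈ cycleRange ψ s t' := h ▸ mem_cycleRange.2 ⟨_, rfl⟩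
  obtain ⟨a, ha⟩ := mem_cycleRange.1 h1
  have h2 := ψ.injective ha
  simp only [Sigma.mk.injEq, heq_eq_eq, true_and, Prod.mk.injEq] at h2
  exact h2.1.symm

theorem sameCycle_iff_mem_cycleRange (hw : ∀ s t a, w (ψ ⟨s, t, a⟩) = ψ ⟨s, t, s.1.perm a⟩)
    (s : ns.support) (t : Fin (ns s.1)) (a : Fin s.1.size) (j : Fin n) :
    j ∈ cycleRange ψ s t ↔ w.SameCycle (ψ ⟨s, t, a⟩) j := by
  have hpow : ∀ (m : ℕ) (a), (w ^ m) (ψ ⟨s, t, a⟩) = ψ ⟨s, t, (s.1.perm ^ m) a⟩ := by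
    intro m
    induction m with
    | zero => intro a; rfl
    | succ m ih =>
      intro a
      rw [pow_succ, pow_succ, Equiv.Perm.mul_apply, Equiv.Perm.mul_apply, hw, ih]
  rw [mem_cycleRange]
  constructor
  · rintro ⟨b, rfl⟩
    obtain ⟨m, rfl⟩ := (s.1.transitive a b).exists_nat_pow_eq
    exact ⟨m, by rw [zpow_natCast, hpow]⟩
  · intro h
    obtain ⟨m, rfl⟩ := h.exists_nat_pow_eq
    exact ⟨_, (hpow m a).symm⟩

/-- The order preserving numbering of one of the cycles in an assembly. -/
noncomputable def cycleRangeIso (hmono : ∀ s t, StrictMono fun a => ψ ⟨s, t, a⟩) (s : ns.support)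
    (t : Fin (ns s.1)) : Fin s.1.size ≃o cycleRange ψ s t :=
  StrictMono.orderIsoOfSurjective
    (fun a => (⟨ψ ⟨s, t, a⟩, mem_cycleRange.2 ⟨a, rfl⟩⟩ : cycleRange ψ s t))
    (fun _ _ hab => hmono s t hab)
    (fun i => by
      obtain ⟨a, ha⟩ := mem_cycleRange.1 i.2
      exact ⟨a, Subtype.ext ha⟩)

theorem mem_cyclesOfShape_iff_exists_cycleRange
    (hw : ∀ s t a, w (ψ ⟨s, t, a⟩) = ψ ⟨s, t, s.1.perm a⟩)
    (hmono : ∀ s t, StrictMono fun a => ψ ⟨s, t, a⟩) {s : CycleShape} {O : Finset (Fin n)} :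
    O ∈ cyclesOfShape w s ↔ ∃ (h : s ∈ ns.support) (t : Fin (ns s)), cycleRange ψ ⟨s, h⟩ t = O := by
  have hshape : ∀ s t, HasShape w (cycleRange ψ s t) s.1 := fun s t =>
    ⟨cycleRangeIso hmono s t, fun a => hw s t a⟩
  rw [mem_cyclesOfShape]
  constructor
  · rintro ⟨hO, hs⟩
    obtain ⟨i, hi⟩ := mem_cycleSupports.1 hO
    obtain ⟨⟨s', t, a⟩, rfl⟩ := ψ.surjective i
    obtain rfl : cycleRange ψ s' t = O := Finset.ext fun j => by
      rw [hi, sameCycle_iff_mem_cycleRange hw s' t a]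
    obtain rfl := hs.unique (hshape s' t)
    exact ⟨s'.2, t, rfl⟩
  · rintro ⟨h, t, rfl⟩
    exact ⟨mem_cycleSupports.2 ⟨_, sameCycle_iff_mem_cycleRange hw ⟨s, h⟩ t ⟨0, s.size_pos⟩⟩,
      hshape ⟨s, h⟩ t⟩

theorem cycleWords_of_assembly {x : Fin n → Fin k}
    {y : ∀ s : ns.support, Fin (ns s.1) → {y : Fin s.1.size → Fin k // std y = s.1.perm}}
    (hx : ∀ s t a, x (ψ ⟨s, t, a⟩) = (y s t).1 a)
    (hw : ∀ s t a, std x (ψ ⟨s, t, a⟩) = ψ ⟨s, t, s.1.perm a⟩)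
    (hmono : ∀ s t, StrictMono fun a => ψ ⟨s, t, a⟩) (s : ns.support) :
    cycleWords x s.1 = Finset.univ.val.map (y s) := by
  let e : Fin (ns s.1) ≃ {O // O ∈ cyclesOfShape (std x) s.1} := Equiv.ofBijective
    (fun t => ⟨cycleRange ψ s t,
      (mem_cyclesOfShape_iff_exists_cycleRange hw hmono).2 ⟨s.2, t, rfl⟩⟩)
    ⟨fun t t' h => cycleRange_injective s (congrArg Subtype.val h), fun O => by
      obtain ⟨_, t, ht⟩ := (mem_cyclesOfShape_iff_exists_cycleRange hw hmono).1 O.2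
      exact ⟨t, Subtype.ext ht⟩⟩
  rw [cycleWords, ← Multiset.map_univ_val_equiv e, Multiset.map_map]
  refine Multiset.map_congr rfl fun t _ => Subtype.ext (funext fun a => ?_)
  rw [Function.comp_apply, ← hx]
  exact HasShape.word_apply _ x (cycleRangeIso hmono s t) a

theorem numCyclesOfShape_of_assembly {x : Fin n → Fin k}
    {y : ∀ s : ns.support, Fin (ns s.1) → {y : Fin s.1.size → Fin k // std y = s.1.perm}}
    (hx : ∀ s t a, x (ψ ⟨s, t, a⟩) = (y s t).1 a)
    (hw : ∀ s t a, std x (ψ ⟨s, t, a⟩) = ψ ⟨s, t, s.1.perm a⟩)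
    (hmono : ∀ s t, StrictMono fun a => ψ ⟨s, t, a⟩) (s : CycleShape) :
    numCyclesOfShape (std x) s = ns s := by
  by_cases hs : s ∈ ns.support
  · rw [← card_cycleWords, cycleWords_of_assembly hx hw hmono ⟨s, hs⟩, Multiset.card_map]
    exact Finset.card_fin _
  · rw [Finsupp.notMem_support_iff.1 hs]
    refine Finset.card_eq_zero.2 (Finset.eq_empty_of_forall_notMem fun O hO => hs ?_)
    exact ((mem_cyclesOfShape_iff_exists_cycleRange hw hmono).1 hO).1

end Assembly

theorem exists_map_univ_eq {α : Type*} {m : ℕ} (c : Multiset α) (h : c.card = m) :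
    ∃ y : Fin m → α, Finset.univ.val.map y = c := by
  obtain ⟨l, rfl⟩ : ∃ l : List α, (l : Multiset α) = c := ⟨c.toList, c.coe_toList⟩
  obtain rfl : l.length = m := h
  exact ⟨l.get, by rw [Fin.univ_val_map, List.ofFn_get]⟩

/-! ### Counting words by the shapes of the cycles -/

/-- Taking cycle words is a bijection between the words whose standardization has `ns s` cycles of
each shape `s` and the families of multisets of `ns s` words with standardization `s`. -/
theorem card_words_numCyclesOfShape (k n : ℕ) (hk : 0 < k) (ns : CycleShape →₀ ℕ)
    (hn : (ns.sum fun s m => s.size * m) = n) :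
    Nat.card {x : Fin n → Fin k // ∀ s, numCyclesOfShape (std x) s = ns s} =
      ns.prod fun s m =>
        ((s.size + k - numDescents s.perm⁻¹ - 1).choose s.size + m - 1).choose m := by
  classical
  let F : {x : Fin n → Fin k // ∀ s, numCyclesOfShape (std x) s = ns s} →
      ∀ s : ns.support, Sym {y : Fin s.1.size → Fin k // std y = s.1.perm} (ns s.1) := fun x s =>
    ⟨cycleWords x.1 s.1, (card_cycleWords x.1 s.1).trans (x.2 s.1)⟩
  have hF : Function.Bijective F := by
    refine ⟨fun x x' h => Subtype.ext (eq_of_cycleWords_eq ns x.2 x'.2 fun s hs => ?_),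
      fun c => ?_⟩
    · exact congrArg Subtype.val (congrFun h ⟨s, hs⟩)
    · choose y hy using fun s => exists_map_univ_eq (c s).1 (c s).2
      obtain ⟨x, ψ, hx, hw, hmono⟩ := exists_assembly ns hn y
      refine ⟨⟨x, numCyclesOfShape_of_assembly hx hw hmono⟩, funext fun s => Subtype.ext ?_⟩
      exact (cycleWords_of_assembly hx hw hmono s).trans (hy s)
  rw [Nat.card_congr (Equiv.ofBijective F hF), Nat.card_pi, Finsupp.prod,
    ← Finset.prod_coe_sort ns.support fun s =>
      ((s.size + k - numDescents s.perm⁻¹ - 1).choose s.size + ns s - 1).choose (ns s)]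
  refine Finset.prod_congr rfl fun s _ => ?_
  rw [Nat.card_eq_fintype_card, Sym.card_sym_eq_choose, ← Nat.card_eq_fintype_card,
    card_std_eq _ k s.1.size_pos hk]

end RiffleShuffle

theorem mainTheorem7 (k n : ℕ) (hk : 0 < k) (ns : RiffleShuffle.CycleShape →₀ ℕ)
    (hn : (ns.sum fun s m => s.size * m) = n) :
    (RiffleShuffle.kShuffle k n hk).toOuterMeasure
        {w | ∀ s, RiffleShuffle.numCyclesOfShape w s = ns s} =
      1 / (k : ENNReal) ^ n *
        ((ns.prod fun s m =>
          ((s.size + k - RiffleShuffle.numDescents s.perm⁻¹ - 1).choose s.size + m - 1).choose m :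
            ℕ) : ENNReal) := by
  classical
  rw [RiffleShuffle.kShuffle_toOuterMeasure,
    ← RiffleShuffle.card_words_numCyclesOfShape k n hk ns hn, Nat.card_eq_fintype_card,
    Fintype.card_subtype, one_div, mul_comm, div_eq_mul_inv]
  congr
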